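/- **The type theory.** Consider Martin-Löf type theory with a cumulative hierarchy $\mathsf{Set}_0:\mathsf{Set}_1:\cdots$ (write $\mathsf{Set}=\mathsf{Set}_0$), $\Pi$-types, $\Sigma$-types, a unit type, and contexts of hypotheses $x:S$ and definitions $x\mapsto t:S$. A context is *valid* when it is empty, or extends a valid context $\Gamma$ by $x:S$ or $x\mapsto t:S$ with $x\notin\Gamma$, $\Gamma\vdash S:\mathsf{Set}_k$ for some $k$ and, for a definition, $\Gamma\vdash t:S$. The theory also has: * a type $\mathsf{UId}$ of tags, codes $\mathsf{EnumU}$ of finite enumerations of tags, the type $\mathsf{EnumT}\,E$ of elements of $E$, and its eliminator; * the universe $\mathsf{Desc}:\mathsf{Set}_1$ of descriptions with codes $\mathsf{'var}$, $\mathsf{'1}$, $A\mathbin{'\!\times}B$, $\mathsf{'\Pi}\,S\,T$, $\mathsf{'\Sigma}\,S\,T$ (for $S:\mathsf{Set}$, $T:S\to\mathsf{Desc}$) and $\mathsf{'\sigma}\,E\,T$ (for $E:\mathsf{EnumU}$, $T:\mathsf{EnumT}\,E\to\mathsf{Desc}$), its interpretation in endofunctors of $\mathsf{Set}$, the least fix-point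 $\mu D:\mathsf{Set}$, and induction; and the analogous universe of indexed descriptions; * labels $l$, i.e. a name followed by well-typed arguments; for each label the type $\langle l\rangle:\mathsf{Set}_1$, with $\mathsf{return}\,E\,T:\langle l\rangle$ for $E:\mathsf{EnumU}$ and $T:\mathsf{EnumT}\,E\to\mathsf{Desc}$, and $\mathsf{call}\,\langle l\rangle\,t:\mathsf{Desc}$ for $t:\langle l\rangle$, where $\mathsf{call}\,\langle l\rangle\,(\mathsf{return}\,E\,T)\equiv\mathsf{'\sigma}\,E\,T$; and likewise programming labels. External terms are elaborated to terms of this theory by a bidirectional system; write $\Gamma\vdash T\ni t\rightsquigarrow t'$ when $t$ is checked against $T$ and elaborates to $t'$. External terms include tuples, finite sets of tags and functions defined by cases over them, and constructors applied to arguments. **Elaboration of definitions.** An inductive definition $\mathsf{data}\ D\ (\vec p:\vec P):\mathsf{Set}$ has a list of constructors, each a tag with a list of arguments. Under a label $l$, the arguments elaborate to a code as follows. * The empty list gives $\mathsf{'1}$. * $(x:T)\,\Delta$ gives $\mathsf{'\Sigma}\,T'\,(\lambda x.\,c)$ if $\Gamma\vdash\mathsf{Set}\ni T\rightsquigarrow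 T'$ and $\Delta$ gives $c$ in $\Gamma,x:T'$. * $(x:T)\,\Delta$ gives $\mathsf{'var}\mathbin{'\!\times}c$ if $T$ is the datatype named by $l$ applied to exactly the parameters in $l$, and $\Delta$ gives $c$ in $\Gamma$. * $(f:(t:T)\to\nabla)\,\Delta$ gives $(\mathsf{'\Pi}\,T'\,(\lambda t.\,b))\mathbin{'\!\times}c$ if $\Gamma\vdash\mathsf{Set}\ni T\rightsquigarrow T'$, the list $\nabla$ gives $b$ in $\Gamma,t:T'$, and $\Delta$ gives $c$ in $\Gamma$. If the constructors have tags $t_i$ and their arguments give codes $c_i$, the choice of constructors elaborates under $l$ to $\mathsf{return}\,E\,T$ whenever $\Gamma\vdash\mathsf{EnumU}\ni\{t_i\}_i\rightsquigarrow E$ and $\Gamma\vdash(\mathsf{EnumT}\,E\to\mathsf{Desc})\ni\{t_i\mapsto c_i\}_i\rightsquigarrow T$. The definition of $D$ elaborates in $\Gamma$ to the context $$\Delta=\Gamma,\; D\mapsto\lambda\vec p.\,\mu(\mathsf{call}\,\langle D\,\vec p\rangle\,\mathit{code})\;:\;(\vec p:\vec P')\to\mathsf{Set}$$ whenever $D\notin\Gamma$,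 $\;\Gamma\vdash\mathsf{Set}_1\ni\big((\vec p:\vec P)\to\mathsf{Set}\big)\rightsquigarrow\big((\vec p:\vec P')\to\mathsf{Set}\big)$, and the choice of constructors elaborates under the label $D\,\vec p$ to $\mathit{code}$ in the context $\Gamma,\vec p:\vec P'$. **Theorem (soundness of elaboration).** If an inductive definition $\mathsf{data}\ D\ (\vec p:\vec P):\mathsf{Set}$ with a given choice of constructors elaborates in $\Gamma$ to a context $\Delta$, then $\Delta$ is a valid context. -/

import Mathlib

namespace DescTT

/-! ## Internal language: raw terms

Variables are de Bruijn indices, so terms are taken up to renaming of bound variables.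
Names and tags are character strings. -/

inductive Tm : Type
  | var (i : ℕ)
  -- the hierarchy of universes
  | set (k : ℕ)
  -- functions: `pi S T` and `lam S t` bind one variable in `T` and `t`
  | pi (S T : Tm)
  | lam (S t : Tm)
  | app (f s : Tm)
  -- pairs: `sig S T` binds one variable in `T`; in `pair s t T` the last `T` is the annotation `x.T`
  | sig (S T : Tm)
  | pair (s t T : Tm)
  | fst (p : Tm)
  | snd (p : Tm)
  | unit
  | star
  -- tags and the universe of enumerations
  | uid
  | tag (a : String)
  | enumU
  | nilE
  | consE (t E : Tm)
  | enumT (E : Tm)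
  | zeroE
  | sucE (n : Tm)
  -- the small product over an enumeration, and the eliminator of enumerations
  | spi (E P : Tm)
  | enumElim (E P es : Tm)
  -- the universe of inductive types
  | desc
  | dvar
  | dunit
  | dtimes (A B : Tm)
  | dpi (S T : Tm)
  | dsigma (S T : Tm)
  | dsig (E T : Tm)
  | interp (D X : Tm)
  | mu (D : Tm)
  | con (d : Tm)
  -- inductive hypotheses, their pointwise proof, and induction
  | all (D X P d : Tm)
  | allMap (D X P p d : Tm)
  | ind (D P h : Tm)
  -- the universe of inductive families
  | idesc (I : Tm)
  | ivar (i : Tm)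
  | iunit
  | itimes (A B : Tm)
  | ipi (S T : Tm)
  | isigma (S T : Tm)
  | isig (E T : Tm)
  | iinterp (D X : Tm)
  | imu (R : Tm)
  | icon (d : Tm)
  | iall (D X d P : Tm)
  | iallMap (D X P p d : Tm)
  | iind (R P h : Tm)
  -- labels: a name followed by arguments
  | lname (f : String)
  | lapp (l t : Tm)
  -- description labels: the type `⟨l⟩`, its introduction and its elimination
  | dlab (l : Tm)
  | dret (E T : Tm)
  | dcall (l t : Tm)
  -- programming labels: the type `⟨l : T⟩`, its introduction and its elimination
  | plab (l T : Tm)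
  | pret (t : Tm)
  | pcall (l T t : Tm)

namespace Tm

/-- Extension of a renaming under a binder. -/
def upr (ρ : ℕ → ℕ) : ℕ → ℕ
  | 0 => 0
  | i + 1 => ρ i + 1

def rename : (ℕ → ℕ) → Tm → Tm
  | ρ, var i => var (ρ i)
  | _, set k => set k
  | ρ, pi S T => pi (rename ρ S) (rename (upr ρ) T)
  | ρ, lam S t => lam (rename ρ S) (rename (upr ρ) t)
  | ρ, app f s => app (rename ρ f) (rename ρ s)
  | ρ, sig S T => sig (rename ρ S) (rename (upr ρ) T)
  | ρ, pair s t T => pair (rename ρ s) (rename ρ t) (rename (upr ρ) T)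
  | ρ, fst p => fst (rename ρ p)
  | ρ, snd p => snd (rename ρ p)
  | _, unit => unit
  | _, star => star
  | _, uid => uid
  | _, tag a => tag a
  | _, enumU => enumU
  | _, nilE => nilE
  | ρ, consE t E => consE (rename ρ t) (rename ρ E)
  | ρ, enumT E => enumT (rename ρ E)
  | _, zeroE => zeroE
  | ρ, sucE n => sucE (rename ρ n)
  | ρ, spi E P => spi (rename ρ E) (rename ρ P)
  | ρ, enumElim E P es => enumElim (rename ρ E) (rename ρ P) (rename ρ es)
  | _, desc => desc
  | _, dvar => dvar
  | _, dunit => dunit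
  | ρ, dtimes A B => dtimes (rename ρ A) (rename ρ B)
  | ρ, dpi S T => dpi (rename ρ S) (rename ρ T)
  | ρ, dsigma S T => dsigma (rename ρ S) (rename ρ T)
  | ρ, dsig E T => dsig (rename ρ E) (rename ρ T)
  | ρ, interp D X => interp (rename ρ D) (rename ρ X)
  | ρ, mu D => mu (rename ρ D)
  | ρ, con d => con (rename ρ d)
  | ρ, all D X P d => all (rename ρ D) (rename ρ X) (rename ρ P) (rename ρ d)
  | ρ, allMap D X P p d =>
      allMap (rename ρ D) (rename ρ X) (rename ρ P) (rename ρ p) (rename ρ d)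
  | ρ, ind D P h => ind (rename ρ D) (rename ρ P) (rename ρ h)
  | ρ, idesc I => idesc (rename ρ I)
  | ρ, ivar i => ivar (rename ρ i)
  | _, iunit => iunit
  | ρ, itimes A B => itimes (rename ρ A) (rename ρ B)
  | ρ, ipi S T => ipi (rename ρ S) (rename ρ T)
  | ρ, isigma S T => isigma (rename ρ S) (rename ρ T)
  | ρ, isig E T => isig (rename ρ E) (rename ρ T)
  | ρ, iinterp D X => iinterp (rename ρ D) (rename ρ X)
  | ρ, imu R => imu (rename ρ R)
  | ρ, icon d => icon (rename ρ d)
  | ρ, iall D X d P => iall (rename ρ D) (rename ρ X) (rename ρ d) (rename ρ P)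
  | ρ, iallMap D X P p d =>
      iallMap (rename ρ D) (rename ρ X) (rename ρ P) (rename ρ p) (rename ρ d)
  | ρ, iind R P h => iind (rename ρ R) (rename ρ P) (rename ρ h)
  | _, lname f => lname f
  | ρ, lapp l t => lapp (rename ρ l) (rename ρ t)
  | ρ, dlab l => dlab (rename ρ l)
  | ρ, dret E T => dret (rename ρ E) (rename ρ T)
  | ρ, dcall l t => dcall (rename ρ l) (rename ρ t)
  | ρ, plab l T => plab (rename ρ l) (rename ρ T)
  | ρ, pret t => pret (rename ρ t)
  | ρ, pcall l T t => pcall (rename ρ l) (rename ρ T) (rename ρ t)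

/-- Weakening by one variable. -/
def wk (t : Tm) : Tm := rename Nat.succ t

/-- Weakening by `n` variables. -/
def wkn (n : ℕ) (t : Tm) : Tm := rename (fun i => i + n) t

/-- Extension of a substitution under a binder. -/
def ups (σ : ℕ → Tm) : ℕ → Tm
  | 0 => var 0
  | i + 1 => wk (σ i)

def subst : (ℕ → Tm) → Tm → Tm
  | σ, var i => σ i
  | _, set k => set k
  | σ, pi S T => pi (subst σ S) (subst (ups σ) T)
  | σ, lam S t => lam (subst σ S) (subst (ups σ) t)
  | σ, app f s => app (subst σ f) (subst σ s)
  | σ, sig S T => sig (subst σ S) (subst (ups σ) T)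
  | σ, pair s t T => pair (subst σ s) (subst σ t) (subst (ups σ) T)
  | σ, fst p => fst (subst σ p)
  | σ, snd p => snd (subst σ p)
  | _, unit => unit
  | _, star => star
  | _, uid => uid
  | _, tag a => tag a
  | _, enumU => enumU
  | _, nilE => nilE
  | σ, consE t E => consE (subst σ t) (subst σ E)
  | σ, enumT E => enumT (subst σ E)
  | _, zeroE => zeroE
  | σ, sucE n => sucE (subst σ n)
  | σ, spi E P => spi (subst σ E) (subst σ P)
  | σ, enumElim E P es => enumElim (subst σ E) (subst σ P) (subst σ es)
  | _, desc => desc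
  | _, dvar => dvar
  | _, dunit => dunit
  | σ, dtimes A B => dtimes (subst σ A) (subst σ B)
  | σ, dpi S T => dpi (subst σ S) (subst σ T)
  | σ, dsigma S T => dsigma (subst σ S) (subst σ T)
  | σ, dsig E T => dsig (subst σ E) (subst σ T)
  | σ, interp D X => interp (subst σ D) (subst σ X)
  | σ, mu D => mu (subst σ D)
  | σ, con d => con (subst σ d)
  | σ, all D X P d => all (subst σ D) (subst σ X) (subst σ P) (subst σ d)
  | σ, allMap D X P p d =>
      allMap (subst σ D) (subst σ X) (subst σ P) (subst σ p) (subst σ d)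
  | σ, ind D P h => ind (subst σ D) (subst σ P) (subst σ h)
  | σ, idesc I => idesc (subst σ I)
  | σ, ivar i => ivar (subst σ i)
  | _, iunit => iunit
  | σ, itimes A B => itimes (subst σ A) (subst σ B)
  | σ, ipi S T => ipi (subst σ S) (subst σ T)
  | σ, isigma S T => isigma (subst σ S) (subst σ T)
  | σ, isig E T => isig (subst σ E) (subst σ T)
  | σ, iinterp D X => iinterp (subst σ D) (subst σ X)
  | σ, imu R => imu (subst σ R)
  | σ, icon d => icon (subst σ d)
  | σ, iall D X d P => iall (subst σ D) (subst σ X) (subst σ d) (subst σ P)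
  | σ, iallMap D X P p d =>
      iallMap (subst σ D) (subst σ X) (subst σ P) (subst σ p) (subst σ d)
  | σ, iind R P h => iind (subst σ R) (subst σ P) (subst σ h)
  | _, lname f => lname f
  | σ, lapp l t => lapp (subst σ l) (subst σ t)
  | σ, dlab l => dlab (subst σ l)
  | σ, dret E T => dret (subst σ E) (subst σ T)
  | σ, dcall l t => dcall (subst σ l) (subst σ t)
  | σ, plab l T => plab (subst σ l) (subst σ T)
  | σ, pret t => pret (subst σ t)
  | σ, pcall l T t => pcall (subst σ l) (subst σ T) (subst σ t)

/-- `inst t s` is `t[s/x]`, where `x` is the most recently bound variable of `t`. -/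
def inst (t s : Tm) : Tm :=
  subst (fun i => match i with
    | 0 => s
    | j + 1 => var j) t

/-- Non-dependent function type. -/
def arr (S T : Tm) : Tm := pi S (wk T)

/-- Non-dependent product type. -/
def prod (S T : Tm) : Tm := sig S (wk T)

/-- Iterated function type over a telescope; each type may mention the previous variables. -/
def pis : List (String × Tm) → Tm → Tm
  | [], T => T
  | p :: ps, T => pi p.2 (pis ps T)

/-- Iterated abstraction over a telescope. -/
def lams : List (String × Tm) → Tm → Tm
  | [], t => t
  | p :: ps, t => lam p.2 (lams ps t)

/-- The label `D p₁ … pₙ`, in a context ending with the `n` variables `p₁, …, pₙ`. -/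
def paramLabel (D : String) : ℕ → Tm
  | 0 => lname D
  | n + 1 => lapp (wk (paramLabel D n)) (var 0)

end Tm

open Tm

/-! ## Contexts -/

/-- A context entry is a hypothesis `x : S` (no value) or a definition `x ↦ t : S`. -/
structure Entry where
  name : String
  type : Tm
  value : Option Tm

/-- The most recent entry comes first; its type lives in the rest of the context. -/
abbrev Ctx := List Entry

/-- `Γ ; x : S` -/
def Ctx.hyp (Γ : Ctx) (x : String) (S : Tm) : Ctx := ⟨x, S, none⟩ :: Γ

/-- `Γ ; x ↦ t : S` -/
def Ctx.defn (Γ : Ctx) (x : String) (t S : Tm) : Ctx := ⟨x, S, some t⟩ :: Γ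

def Ctx.names (Γ : Ctx) : List String := Γ.map Entry.name

/-- Extension of a context by a telescope of hypotheses, first component first. -/
def Ctx.tele : Ctx → List (String × Tm) → Ctx
  | Γ, [] => Γ
  | Γ, p :: ps => Ctx.tele (Ctx.hyp Γ p.1 p.2) ps

/-! ## Computation rules of the operations defined by recursion on codes -/

inductive Comp : Tm → Tm → Prop
  -- enumerations
  | spi_nil {P} : Comp (spi nilE P) unit
  | spi_cons {t E P} : Comp (spi (consE t E) P)
      (prod (app P zeroE) (spi E (lam (enumT E) (app (wk P) (sucE (var 0))))))
  | enumElim_zero {t E P es} : Comp (app (enumElim (consE t E) P es) zeroE) (fst es)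
  | enumElim_suc {t E P es n} : Comp (app (enumElim (consE t E) P es) (sucE n))
      (app (enumElim E (lam (enumT E) (app (wk P) (sucE (var 0)))) (snd es)) n)
  -- interpretation of descriptions
  | interp_var {X} : Comp (interp dvar X) X
  | interp_unit {X} : Comp (interp dunit X) unit
  | interp_times {A B X} : Comp (interp (dtimes A B) X) (prod (interp A X) (interp B X))
  | interp_pi {S T X} : Comp (interp (dpi S T) X)
      (pi S (interp (app (wk T) (var 0)) (wk X)))
  | interp_sigma {S T X} : Comp (interp (dsigma S T) X)
      (sig S (interp (app (wk T) (var 0)) (wk X)))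
  | interp_sig {E T X} : Comp (interp (dsig E T) X)
      (sig (enumT E) (interp (app (wk T) (var 0)) (wk X)))
  -- inductive hypotheses
  | all_var {X P d} : Comp (all dvar X P d) (app P d)
  | all_unit {X P d} : Comp (all dunit X P d) unit
  | all_times {A B X P d} : Comp (all (dtimes A B) X P d)
      (prod (all A X P (fst d)) (all B X P (snd d)))
  | all_pi {S T X P d} : Comp (all (dpi S T) X P d)
      (pi S (all (app (wk T) (var 0)) (wk X) (wk P) (app (wk d) (var 0))))
  | all_sigma {S T X P d} : Comp (all (dsigma S T) X P d) (all (app T (fst d)) X P (snd d))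
  | all_sig {E T X P d} : Comp (all (dsig E T) X P d) (all (app T (fst d)) X P (snd d))
  | allMap_var {X P p d} : Comp (allMap dvar X P p d) (app p d)
  | allMap_unit {X P p d} : Comp (allMap dunit X P p d) star
  | allMap_times {A B X P p d} : Comp (allMap (dtimes A B) X P p d)
      (pair (allMap A X P p (fst d)) (allMap B X P p (snd d)) (wk (all B X P (snd d))))
  | allMap_pi {S T X P p d} : Comp (allMap (dpi S T) X P p d)
      (lam S (allMap (app (wk T) (var 0)) (wk X) (wk P) (wk p) (app (wk d) (var 0))))
  | allMap_sigma {S T X P p d} : Comp (allMap (dsigma S T) X P p d)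
      (allMap (app T (fst d)) X P p (snd d))
  | allMap_sig {E T X P p d} : Comp (allMap (dsig E T) X P p d)
      (allMap (app T (fst d)) X P p (snd d))
  | ind_con {D P h d} : Comp (app (ind D P h) (con d))
      (app (app h d) (allMap D (mu D) P (ind D P h) d))
  -- the same, for indexed descriptions
  | iinterp_var {i X} : Comp (iinterp (ivar i) X) (app X i)
  | iinterp_unit {X} : Comp (iinterp iunit X) unit
  | iinterp_times {A B X} : Comp (iinterp (itimes A B) X) (prod (iinterp A X) (iinterp B X))
  | iinterp_pi {S T X} : Comp (iinterp (ipi S T) X)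
      (pi S (iinterp (app (wk T) (var 0)) (wk X)))
  | iinterp_sigma {S T X} : Comp (iinterp (isigma S T) X)
      (sig S (iinterp (app (wk T) (var 0)) (wk X)))
  | iinterp_sig {E T X} : Comp (iinterp (isig E T) X)
      (sig (enumT E) (iinterp (app (wk T) (var 0)) (wk X)))
  | iall_var {i X d P} : Comp (iall (ivar i) X d P)
      (app P (pair i d (app (wk X) (var 0))))
  | iall_unit {X d P} : Comp (iall iunit X d P) unit
  | iall_times {A B X d P} : Comp (iall (itimes A B) X d P)
      (prod (iall A X (fst d) P) (iall B X (snd d) P))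
  | iall_pi {S T X d P} : Comp (iall (ipi S T) X d P)
      (pi S (iall (app (wk T) (var 0)) (wk X) (app (wk d) (var 0)) (wk P)))
  | iall_sigma {S T X d P} : Comp (iall (isigma S T) X d P)
      (iall (app T (fst d)) X (snd d) P)
  | iall_sig {E T X d P} : Comp (iall (isig E T) X d P) (iall (app T (fst d)) X (snd d) P)
  | iallMap_var {i X P p d} : Comp (iallMap (ivar i) X P p d) (app (app p i) d)
  | iallMap_unit {X P p d} : Comp (iallMap iunit X P p d) star
  | iallMap_times {A B X P p d} : Comp (iallMap (itimes A B) X P p d)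
      (pair (iallMap A X P p (fst d)) (iallMap B X P p (snd d)) (wk (iall B X (snd d) P)))
  | iallMap_pi {S T X P p d} : Comp (iallMap (ipi S T) X P p d)
      (lam S (iallMap (app (wk T) (var 0)) (wk X) (wk P) (wk p) (app (wk d) (var 0))))
  | iallMap_sigma {S T X P p d} : Comp (iallMap (isigma S T) X P p d)
      (iallMap (app T (fst d)) X P p (snd d))
  | iallMap_sig {E T X P p d} : Comp (iallMap (isig E T) X P p d)
      (iallMap (app T (fst d)) X P p (snd d))
  | iind_con {R P h i d} : Comp (app (app (iind R P h) i) (icon d))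
      (app (app (app h i) d) (iallMap (app R i) (imu R) P (iind R P h) d))
  -- labels
  | dcall_dret {l E T} : Comp (dcall l (dret E T)) (dsig E T)
  | pcall_pret {l T t} : Comp (pcall l T (pret t)) t

/-! ## Judgments of the type theory -/

inductive Judgment : Type
  /-- `Γ` is a valid context -/
  | valid (Γ : Ctx)
  /-- `Γ ⊢ t : T` -/
  | typ (Γ : Ctx) (t T : Tm)
  /-- `Γ ⊢ s ≡ t : T` -/
  | eq (Γ : Ctx) (s t T : Tm)
  /-- `l` is a label in `Γ`: a name followed by well-typed arguments -/
  | label (Γ : Ctx) (l : Tm)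

open Judgment

/-- Derivability of the (mutually defined) judgments of the type theory. -/
inductive Derivable : Judgment → Prop
  -- context validity
  | valid_nil : Derivable (valid [])
  | valid_hyp {Γ x S k} : Derivable (valid Γ) → Derivable (typ Γ S (set k)) → x ∉ Ctx.names Γ →
      Derivable (valid (Ctx.hyp Γ x S))
  | valid_defn {Γ x t S k} : Derivable (valid Γ) → Derivable (typ Γ S (set k)) →
      Derivable (typ Γ t S) → x ∉ Ctx.names Γ → Derivable (valid (Ctx.defn Γ x t S))
  -- structural rules and universes
  | var {Γ i e} : Derivable (valid Γ) → Γ[i]? = some e →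
      Derivable (typ Γ (var i) (wkn (i + 1) e.type))
  | conv {Γ t S T k} : Derivable (typ Γ t S) → Derivable (eq Γ S T (set k)) →
      Derivable (typ Γ t T)
  | set {Γ k} : Derivable (valid Γ) → Derivable (typ Γ (set k) (set (k + 1)))
  | cumul {Γ T k} : Derivable (typ Γ T (set k)) → Derivable (typ Γ T (set (k + 1)))
  -- functions
  | pi {Γ x S T k} : Derivable (typ Γ S (set k)) → Derivable (typ (Ctx.hyp Γ x S) T (set k)) →
      Derivable (typ Γ (pi S T) (set k))
  | lam {Γ x S t T k} : Derivable (typ Γ S (set k)) → Derivable (typ (Ctx.hyp Γ x S) t T) →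
      Derivable (typ Γ (lam S t) (pi S T))
  | app {Γ f s S T} : Derivable (typ Γ f (pi S T)) → Derivable (typ Γ s S) →
      Derivable (typ Γ (app f s) (inst T s))
  -- pairs
  | sig {Γ x S T k} : Derivable (typ Γ S (set k)) → Derivable (typ (Ctx.hyp Γ x S) T (set k)) →
      Derivable (typ Γ (sig S T) (set k))
  | pair {Γ x s t S T k} : Derivable (typ Γ s S) → Derivable (typ (Ctx.hyp Γ x S) T (set k)) →
      Derivable (typ Γ t (inst T s)) → Derivable (typ Γ (pair s t T) (sig S T))
  | fst {Γ p S T} : Derivable (typ Γ p (sig S T)) → Derivable (typ Γ (fst p) S)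
  | snd {Γ p S T} : Derivable (typ Γ p (sig S T)) → Derivable (typ Γ (snd p) (inst T (fst p)))
  | unit {Γ} : Derivable (valid Γ) → Derivable (typ Γ unit (set 0))
  | star {Γ} : Derivable (valid Γ) → Derivable (typ Γ star unit)
  -- tags and enumerations
  | uid {Γ} : Derivable (valid Γ) → Derivable (typ Γ uid (set 0))
  | tag {Γ a} : Derivable (valid Γ) → Derivable (typ Γ (tag a) uid)
  | enumU {Γ} : Derivable (valid Γ) → Derivable (typ Γ enumU (set 0))
  | nilE {Γ} : Derivable (valid Γ) → Derivable (typ Γ nilE enumU)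
  | consE {Γ t E} : Derivable (typ Γ t uid) → Derivable (typ Γ E enumU) →
      Derivable (typ Γ (consE t E) enumU)
  | enumT {Γ E} : Derivable (typ Γ E enumU) → Derivable (typ Γ (enumT E) (set 0))
  | zeroE {Γ t E} : Derivable (typ Γ t uid) → Derivable (typ Γ E enumU) →
      Derivable (typ Γ zeroE (enumT (consE t E)))
  | sucE {Γ t E n} : Derivable (typ Γ t uid) → Derivable (typ Γ E enumU) →
      Derivable (typ Γ n (enumT E)) → Derivable (typ Γ (sucE n) (enumT (consE t E)))
  | spi {Γ E P k} : Derivable (typ Γ E enumU) → Derivable (typ Γ P (arr (enumT E) (set k))) →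
      Derivable (typ Γ (spi E P) (set k))
  | enumElim {Γ E P es k} : Derivable (typ Γ E enumU) →
      Derivable (typ Γ P (arr (enumT E) (set k))) → Derivable (typ Γ es (spi E P)) →
      Derivable (typ Γ (enumElim E P es) (pi (enumT E) (app (wk P) (var 0))))
  -- descriptions
  | desc {Γ} : Derivable (valid Γ) → Derivable (typ Γ desc (set 1))
  | dvar {Γ} : Derivable (valid Γ) → Derivable (typ Γ dvar desc)
  | dunit {Γ} : Derivable (valid Γ) → Derivable (typ Γ dunit desc)
  | dtimes {Γ A B} : Derivable (typ Γ A desc) → Derivable (typ Γ B desc) →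
      Derivable (typ Γ (dtimes A B) desc)
  | dpi {Γ S T} : Derivable (typ Γ S (set 0)) → Derivable (typ Γ T (arr S desc)) →
      Derivable (typ Γ (dpi S T) desc)
  | dsigma {Γ S T} : Derivable (typ Γ S (set 0)) → Derivable (typ Γ T (arr S desc)) →
      Derivable (typ Γ (dsigma S T) desc)
  | dsig {Γ E T} : Derivable (typ Γ E enumU) → Derivable (typ Γ T (arr (enumT E) desc)) →
      Derivable (typ Γ (dsig E T) desc)
  | interp {Γ D X} : Derivable (typ Γ D desc) → Derivable (typ Γ X (set 0)) →
      Derivable (typ Γ (interp D X) (set 0))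
  | mu {Γ D} : Derivable (typ Γ D desc) → Derivable (typ Γ (mu D) (set 0))
  | con {Γ D d} : Derivable (typ Γ D desc) → Derivable (typ Γ d (interp D (mu D))) →
      Derivable (typ Γ (con d) (mu D))
  | all {Γ D X P d k} : Derivable (typ Γ D desc) → Derivable (typ Γ X (set 0)) →
      Derivable (typ Γ P (arr X (set k))) → Derivable (typ Γ d (interp D X)) →
      Derivable (typ Γ (all D X P d) (set k))
  | allMap {Γ D X P p d k} : Derivable (typ Γ D desc) → Derivable (typ Γ X (set 0)) →
      Derivable (typ Γ P (arr X (set k))) → Derivable (typ Γ p (pi X (app (wk P) (var 0)))) →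
      Derivable (typ Γ d (interp D X)) → Derivable (typ Γ (allMap D X P p d) (all D X P d))
  | ind {Γ D P h k} : Derivable (typ Γ D desc) → Derivable (typ Γ P (arr (mu D) (set k))) →
      Derivable (typ Γ h
        (pi (interp D (mu D))
          (arr (all (wk D) (wk (mu D)) (wk P) (var 0)) (app (wk P) (con (var 0)))))) →
      Derivable (typ Γ (ind D P h) (pi (mu D) (app (wk P) (var 0))))
  -- indexed descriptions
  | idesc {Γ I} : Derivable (typ Γ I (set 0)) → Derivable (typ Γ (idesc I) (set 1))
  | ivar {Γ I i} : Derivable (typ Γ I (set 0)) → Derivable (typ Γ i I) →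
      Derivable (typ Γ (ivar i) (idesc I))
  | iunit {Γ I} : Derivable (typ Γ I (set 0)) → Derivable (typ Γ iunit (idesc I))
  | itimes {Γ I A B} : Derivable (typ Γ A (idesc I)) → Derivable (typ Γ B (idesc I)) →
      Derivable (typ Γ (itimes A B) (idesc I))
  | ipi {Γ I S T} : Derivable (typ Γ I (set 0)) → Derivable (typ Γ S (set 0)) →
      Derivable (typ Γ T (arr S (idesc I))) → Derivable (typ Γ (ipi S T) (idesc I))
  | isigma {Γ I S T} : Derivable (typ Γ I (set 0)) → Derivable (typ Γ S (set 0)) →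
      Derivable (typ Γ T (arr S (idesc I))) → Derivable (typ Γ (isigma S T) (idesc I))
  | isig {Γ I E T} : Derivable (typ Γ I (set 0)) → Derivable (typ Γ E enumU) →
      Derivable (typ Γ T (arr (enumT E) (idesc I))) → Derivable (typ Γ (isig E T) (idesc I))
  | iinterp {Γ I D X} : Derivable (typ Γ I (set 0)) → Derivable (typ Γ D (idesc I)) →
      Derivable (typ Γ X (arr I (set 0))) → Derivable (typ Γ (iinterp D X) (set 0))
  | imu {Γ I R} : Derivable (typ Γ I (set 0)) → Derivable (typ Γ R (arr I (idesc I))) →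
      Derivable (typ Γ (imu R) (arr I (set 0)))
  | icon {Γ I R i d} : Derivable (typ Γ I (set 0)) → Derivable (typ Γ R (arr I (idesc I))) →
      Derivable (typ Γ i I) → Derivable (typ Γ d (iinterp (app R i) (imu R))) →
      Derivable (typ Γ (icon d) (app (imu R) i))
  | iall {Γ I D X d P k} : Derivable (typ Γ I (set 0)) → Derivable (typ Γ D (idesc I)) →
      Derivable (typ Γ X (arr I (set 0))) → Derivable (typ Γ d (iinterp D X)) →
      Derivable (typ Γ P (arr (sig I (app (wk X) (var 0))) (set k))) →
      Derivable (typ Γ (iall D X d P) (set k))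
  | iallMap {Γ I D X P p d k} : Derivable (typ Γ I (set 0)) → Derivable (typ Γ D (idesc I)) →
      Derivable (typ Γ X (arr I (set 0))) →
      Derivable (typ Γ P (arr (sig I (app (wk X) (var 0))) (set k))) →
      Derivable (typ Γ p (pi I (pi (app (wk X) (var 0))
        (app (wkn 2 P) (pair (var 1) (var 0) (app (wkn 3 X) (var 0))))))) →
      Derivable (typ Γ d (iinterp D X)) →
      Derivable (typ Γ (iallMap D X P p d) (iall D X d P))
  | iind {Γ I R P h k} : Derivable (typ Γ I (set 0)) → Derivable (typ Γ R (arr I (idesc I))) →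
      Derivable (typ Γ P (arr (sig I (app (wk (imu R)) (var 0))) (set k))) →
      Derivable (typ Γ h
        (pi I (pi (iinterp (app (wk R) (var 0)) (wk (imu R)))
          (arr (iall (app (wkn 2 R) (var 1)) (wkn 2 (imu R)) (var 0) (wkn 2 P))
            (app (wkn 2 P)
              (pair (var 1) (icon (var 0)) (app (wkn 3 (imu R)) (var 0)))))))) →
      Derivable (typ Γ (iind R P h)
        (pi I (pi (app (wk (imu R)) (var 0))
          (app (wkn 2 P) (pair (var 1) (var 0) (app (wkn 3 (imu R)) (var 0)))))))
  -- labels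
  | label_name {Γ f} : Derivable (valid Γ) → Derivable (label Γ (lname f))
  | label_app {Γ l t T} : Derivable (label Γ l) → Derivable (typ Γ t T) →
      Derivable (label Γ (lapp l t))
  -- description labels
  | dlab {Γ l} : Derivable (label Γ l) → Derivable (typ Γ (dlab l) (set 1))
  | dret {Γ l E T} : Derivable (label Γ l) → Derivable (typ Γ E enumU) →
      Derivable (typ Γ T (arr (enumT E) desc)) → Derivable (typ Γ (dret E T) (dlab l))
  | dcall {Γ l t} : Derivable (typ Γ t (dlab l)) → Derivable (typ Γ (dcall l t) desc)
  -- programming labels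
  | plab {Γ l T k} : Derivable (label Γ l) → Derivable (typ Γ T (set k)) →
      Derivable (typ Γ (plab l T) (set k))
  | pret {Γ l t T} : Derivable (typ Γ t T) → Derivable (label Γ l) →
      Derivable (typ Γ (pret t) (plab l T))
  | pcall {Γ l T t} : Derivable (typ Γ t (plab l T)) → Derivable (typ Γ (pcall l T t) T)
  -- judgmental equality: an equivalence, stable under conversion
  | eq_refl {Γ t T} : Derivable (typ Γ t T) → Derivable (eq Γ t t T)
  | eq_symm {Γ s t T} : Derivable (eq Γ s t T) → Derivable (eq Γ t s T)
  | eq_trans {Γ s t u T} : Derivable (eq Γ s t T) → Derivable (eq Γ t u T) →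
      Derivable (eq Γ s u T)
  | eq_conv {Γ s t S T k} : Derivable (eq Γ s t S) → Derivable (eq Γ S T (set k)) →
      Derivable (eq Γ s t T)
  | eq_cumul {Γ S T k} : Derivable (eq Γ S T (set k)) → Derivable (eq Γ S T (set (k + 1)))
  -- judgmental equality: a congruence
  | eq_inst {Γ x s t S u T} : Derivable (typ (Ctx.hyp Γ x S) u T) → Derivable (eq Γ s t S) →
      Derivable (eq Γ (inst u s) (inst u t) (inst T s))
  | eq_pi {Γ x S T U V k} : Derivable (eq Γ S U (set k)) →
      Derivable (eq (Ctx.hyp Γ x S) T V (set k)) → Derivable (eq Γ (pi S T) (pi U V) (set k))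
  | eq_lam {Γ x S U t u T k} : Derivable (eq Γ S U (set k)) →
      Derivable (eq (Ctx.hyp Γ x S) t u T) → Derivable (eq Γ (lam S t) (lam U u) (pi S T))
  | eq_sig {Γ x S T U V k} : Derivable (eq Γ S U (set k)) →
      Derivable (eq (Ctx.hyp Γ x S) T V (set k)) → Derivable (eq Γ (sig S T) (sig U V) (set k))
  | eq_pair {Γ x s t S T V k} : Derivable (typ Γ s S) →
      Derivable (eq (Ctx.hyp Γ x S) T V (set k)) → Derivable (typ Γ t (inst T s)) →
      Derivable (eq Γ (pair s t T) (pair s t V) (sig S T))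
  -- judgmental equality: computation
  | beta {Γ x s t S T k} : Derivable (typ Γ S (set k)) → Derivable (typ (Ctx.hyp Γ x S) t T) →
      Derivable (typ Γ s S) → Derivable (eq Γ (app (lam S t) s) (inst t s) (inst T s))
  | fst_pair {Γ x s t S T k} : Derivable (typ Γ s S) →
      Derivable (typ (Ctx.hyp Γ x S) T (set k)) → Derivable (typ Γ t (inst T s)) →
      Derivable (eq Γ (fst (pair s t T)) s S)
  | snd_pair {Γ x s t S T k} : Derivable (typ Γ s S) →
      Derivable (typ (Ctx.hyp Γ x S) T (set k)) → Derivable (typ Γ t (inst T s)) →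
      Derivable (eq Γ (snd (pair s t T)) t (inst T s))
  | delta {Γ i e t} : Derivable (valid Γ) → Γ[i]? = some e → e.value = some t →
      Derivable (eq Γ (var i) (wkn (i + 1) t) (wkn (i + 1) e.type))
  | comp {Γ s t T} : Derivable (typ Γ s T) → Comp s t → Derivable (eq Γ s t T)

/-- `Γ` is a valid context. -/
def Valid (Γ : Ctx) : Prop := Derivable (valid Γ)

/-! ## External language -/

/-- External terms, with named variables. -/
inductive Ext : Type
  | var (x : String)
  -- a term of the internal language
  | core (t : Tm)
  | set (k : ℕ)
  | pi (x : String) (S T : Ext)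
  | sig (x : String) (S T : Ext)
  | lam (x : String) (t : Ext)
  | app (f s : Ext)
  | pair (s t : Ext)
  | fst (p : Ext)
  | snd (p : Ext)
  | unit
  -- type annotation `t : T`
  | ann (t T : Ext)
  -- tuple `(t₀ … tₖ)`
  | tuple (ts : List Ext)
  -- enumeration of tags, elimination by listing the cases, a tag
  | coll (as : List String)
  | cases (bs : List (String × Ext))
  | tag (a : String)
  -- `In t` and the application of a constructor to its arguments
  | con (t : Ext)
  | constr (c : String) (ts : List Ext)

/-- The type `(x₁ : P₁) … (xₙ : Pₙ) → T`. -/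
def Ext.pis : List (String × Ext) → Ext → Ext
  | [], T => T
  | p :: ps, T => Ext.pi p.1 p.2 (Ext.pis ps T)

/-- The arguments of a constructor. -/
inductive Args : Type
  | nil
  -- `(x : T) Δ`
  | cons (x : String) (T : Ext) (Δ : Args)
  -- `(f : (t : T) → Θ) Δ`
  | exp (f : String) (t : String) (T : Ext) (Θ Δ : Args)

/-- The external term `p` denotes the internal term `q` of context `Γ` verbatim. -/
inductive Denotes (Γ : Ctx) : Ext → Tm → Prop
  | var {x i e} : Γ[i]? = some e → e.name = x → Denotes Γ (Ext.var x) (Tm.var i)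
  | core {t} : Denotes Γ (Ext.core t) t

/-- Recursion matching: the external type `T` is the datatype name of the label `l`, applied to
the same parameters as `l`. -/
inductive RecMatch (Γ : Ctx) : Ext → Tm → Prop
  | name {D} : RecMatch Γ (Ext.var D) (lname D)
  | app {T l p q} : RecMatch Γ T l → Denotes Γ p q → RecMatch Γ (Ext.app T p) (lapp l q)

inductive ElabJudgment : Type
  /-- the external `t` is checked against `T` and elaborates to `u` -/
  | check (Γ : Ctx) (T : Tm) (t : Ext) (u : Tm)
  /-- the external `t` elaborates to `u`, of synthesized type `T` -/
  | synth (Γ : Ctx) (t : Ext) (u T : Tm)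
  /-- the arguments `Δ` elaborate to the description `code`, under the description label `l` -/
  | args (Γ : Ctx) (Δ : Args) (l code : Tm)

open ElabJudgment

/-- The (mutually defined) type synthesis, type checking and elaboration of arguments. -/
inductive Elaborates : ElabJudgment → Prop
  -- type synthesis
  | var {Γ i e x} : Derivable (valid Γ) → Γ[i]? = some e → e.name = x →
      Elaborates (synth Γ (Ext.var x) (Tm.var i) (wkn (i + 1) e.type))
  | core {Γ t T} : Derivable (typ Γ t T) → Elaborates (synth Γ (Ext.core t) t T)
  | app {Γ f g s u S T} : Elaborates (synth Γ f g (Tm.pi S T)) → Elaborates (check Γ S s u) →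
      Elaborates (synth Γ (Ext.app f s) (Tm.app g u) (inst T u))
  | fst {Γ p q S T} : Elaborates (synth Γ p q (Tm.sig S T)) →
      Elaborates (synth Γ (Ext.fst p) (Tm.fst q) S)
  | snd {Γ p q S T} : Elaborates (synth Γ p q (Tm.sig S T)) →
      Elaborates (synth Γ (Ext.snd p) (Tm.snd q) (inst T (Tm.fst q)))
  | ann {Γ t u T U k} : Elaborates (check Γ (Tm.set k) T U) → Elaborates (check Γ U t u) →
      Elaborates (synth Γ (Ext.ann t T) u U)
  | synth_conv {Γ t u S T k} : Elaborates (synth Γ t u S) → Derivable (eq Γ S T (Tm.set k)) →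
      Elaborates (synth Γ t u T)
  -- type checking
  | switch {Γ t u T} : Elaborates (synth Γ t u T) → Elaborates (check Γ T t u)
  | check_conv {Γ t u S T k} : Elaborates (check Γ S t u) → Derivable (eq Γ S T (Tm.set k)) →
      Elaborates (check Γ T t u)
  | cumul {Γ t u j k} : Elaborates (check Γ (Tm.set j) t u) → j ≤ k →
      Elaborates (check Γ (Tm.set k) t u)
  | set {Γ j k} : Derivable (valid Γ) → j < k →
      Elaborates (check Γ (Tm.set k) (Ext.set j) (Tm.set j))
  | pi {Γ x S T U V k} : Elaborates (check Γ (Tm.set k) S U) →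
      Elaborates (check (Ctx.hyp Γ x U) (Tm.set k) T V) →
      Elaborates (check Γ (Tm.set k) (Ext.pi x S T) (Tm.pi U V))
  | sig {Γ x S T U V k} : Elaborates (check Γ (Tm.set k) S U) →
      Elaborates (check (Ctx.hyp Γ x U) (Tm.set k) T V) →
      Elaborates (check Γ (Tm.set k) (Ext.sig x S T) (Tm.sig U V))
  | unit {Γ k} : Derivable (valid Γ) → Elaborates (check Γ (Tm.set k) Ext.unit Tm.unit)
  | lam {Γ x t u S T} : Elaborates (check (Ctx.hyp Γ x S) T t u) →
      Elaborates (check Γ (Tm.pi S T) (Ext.lam x t) (Tm.lam S u))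
  | pair {Γ x s t u v S T k} : Derivable (typ (Ctx.hyp Γ x S) T (Tm.set k)) →
      Elaborates (check Γ S s u) → Elaborates (check Γ (inst T u) t v) →
      Elaborates (check Γ (Tm.sig S T) (Ext.pair s t) (Tm.pair u v T))
  -- tuples
  | tuple_nil {Γ} : Derivable (valid Γ) →
      Elaborates (check Γ Tm.unit (Ext.tuple []) Tm.star)
  | tuple_cons {Γ x t ts u us A B k} : Derivable (typ (Ctx.hyp Γ x A) B (Tm.set k)) →
      Elaborates (check Γ A t u) → Elaborates (check Γ (inst B u) (Ext.tuple ts) us) →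
      Elaborates (check Γ (Tm.sig A B) (Ext.tuple (t :: ts)) (Tm.pair u us B))
  -- finite sets
  | coll_nil {Γ} : Derivable (valid Γ) →
      Elaborates (check Γ Tm.enumU (Ext.coll []) Tm.nilE)
  | coll_cons {Γ a as E} : Elaborates (check Γ Tm.enumU (Ext.coll as) E) →
      Elaborates (check Γ Tm.enumU (Ext.coll (a :: as)) (Tm.consE (Tm.tag a) E))
  | cases {Γ bs E P es k} : Elaborates (check Γ Tm.enumU (Ext.coll (bs.map Prod.fst)) E) →
      Derivable (typ Γ P (arr (Tm.enumT E) (Tm.set k))) →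
      Elaborates (check Γ (Tm.spi E P) (Ext.tuple (bs.map Prod.snd)) es) →
      Elaborates (check Γ (Tm.pi (Tm.enumT E) (Tm.app (wk P) (Tm.var 0))) (Ext.cases bs)
        (Tm.enumElim E P es))
  | tag {Γ a} : Derivable (valid Γ) → Elaborates (check Γ Tm.uid (Ext.tag a) (Tm.tag a))
  | tag_zero {Γ a E} : Derivable (typ Γ E Tm.enumU) →
      Elaborates (check Γ (Tm.enumT (Tm.consE (Tm.tag a) E)) (Ext.tag a) Tm.zeroE)
  | tag_suc {Γ a b E n} : Derivable (typ Γ E Tm.enumU) →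
      Elaborates (check Γ (Tm.enumT E) (Ext.tag a) n) →
      Elaborates (check Γ (Tm.enumT (Tm.consE (Tm.tag b) E)) (Ext.tag a) (Tm.sucE n))
  -- inhabitants of fix-points
  | con {Γ D t u} : Derivable (typ Γ D Tm.desc) →
      Elaborates (check Γ (Tm.interp D (Tm.mu D)) t u) →
      Elaborates (check Γ (Tm.mu D) (Ext.con t) (Tm.con u))
  | icon {Γ I R i t u} : Derivable (typ Γ I (Tm.set 0)) →
      Derivable (typ Γ R (arr I (Tm.idesc I))) → Derivable (typ Γ i I) →
      Elaborates (check Γ (Tm.iinterp (Tm.app R i) (Tm.imu R)) t u) →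
      Elaborates (check Γ (Tm.app (Tm.imu R) i) (Ext.con t) (Tm.icon u))
  | constr {Γ E T c ts u} :
      Elaborates (check Γ (Tm.mu (Tm.dsig E T)) (Ext.con (Ext.tuple (Ext.tag c :: ts))) u) →
      Elaborates (check Γ (Tm.mu (Tm.dsig E T)) (Ext.constr c ts) u)
  | iconstr {Γ I R i E T c ts u} :
      Derivable (eq Γ (Tm.app R i) (Tm.isig E T) (Tm.idesc I)) →
      Elaborates (check Γ (Tm.app (Tm.imu R) i) (Ext.con (Ext.tuple (Ext.tag c :: ts))) u) →
      Elaborates (check Γ (Tm.app (Tm.imu R) i) (Ext.constr c ts) u)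
  -- a code that results from the elaboration of arguments is an internal term already: it
  -- elaborates to itself, and no typing of it is asked for
  | code {Γ Δ l c} : Elaborates (args Γ Δ l c) → Elaborates (check Γ Tm.desc (Ext.core c) c)
  -- arguments: an ordinary argument, a recursive argument, an exponential, no argument
  | args_sigma {Γ x T U Δ l c} : Elaborates (check Γ (Tm.set 0) T U) →
      Elaborates (args (Ctx.hyp Γ x U) Δ (wk l) c) →
      Elaborates (args Γ (Args.cons x T Δ) l (Tm.dsigma U (Tm.lam U c)))
  | args_rec {Γ x T Δ l c} : RecMatch Γ T l → Elaborates (args Γ Δ l c) →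
      Elaborates (args Γ (Args.cons x T Δ) l (Tm.dtimes Tm.dvar c))
  | args_pi {Γ f x T U Θ Δ l b c} : Elaborates (check Γ (Tm.set 0) T U) →
      Elaborates (args (Ctx.hyp Γ x U) Θ (wk l) b) → Elaborates (args Γ Δ l c) →
      Elaborates (args Γ (Args.exp f x T Θ Δ) l (Tm.dtimes (Tm.dpi U (Tm.lam U b)) c))
  | args_nil {Γ l} : Derivable (valid Γ) → Elaborates (args Γ Args.nil l Tm.dunit)

/-! ## Elaboration of inductive definitions -/

/-- A constructor declaration: the name and the arguments. -/
structure Constr where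
  name : String
  args : Args

/-- Elaboration of a constructor, to an internal tag and a code. -/
inductive ElabConstr (Γ : Ctx) : Constr → Tm → Tm → Tm → Prop
  | intro {c l t code} : Elaborates (check Γ Tm.uid (Ext.tag c.name) t) →
      Elaborates (args Γ c.args l code) → ElabConstr Γ c l t code

/-- Elaboration of a choice of constructors, to an inhabitant of the description label `⟨l⟩`.
Here `bs` lists the tags and codes of the individual constructors, in order. -/
inductive ElabChoices (Γ : Ctx) : List Constr → Tm → Tm → Prop
  | intro {cs l E T} {bs : List (String × Tm)} :
      List.Forall₂ (fun c b => ElabConstr Γ c l (Tm.tag b.1) b.2) cs bs →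
      Elaborates (check Γ Tm.enumU (Ext.coll (bs.map Prod.fst)) E) →
      Elaborates (check Γ (arr (Tm.enumT E) Tm.desc)
        (Ext.cases (bs.map fun b => (b.1, Ext.core b.2))) T) →
      ElabChoices Γ cs l (Tm.dret E T)

/-- Elaboration of the inductive definition of `D`, with parameters `ps` and the choice `cs` of
constructors, in the context `Γ`; the last argument is the extended context. -/
inductive ElabData (Γ : Ctx) (D : String) (ps : List (String × Ext)) (cs : List Constr) :
    Ctx → Prop
  | intro {qs : List (String × Tm)} {code : Tm} :
      D ∉ Ctx.names Γ →
      qs.map Prod.fst = ps.map Prod.fst →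
      Elaborates (check Γ (Tm.set 1) (Ext.pis ps (Ext.set 0)) (Tm.pis qs (Tm.set 0))) →
      ElabChoices (Ctx.tele Γ qs) cs (paramLabel D qs.length) code →
      ElabData Γ D ps cs
        (Ctx.defn Γ D
          (Tm.lams qs (Tm.mu (Tm.dcall (paramLabel D qs.length) code)))
          (Tm.pis qs (Tm.set 0)))

end DescTT

/-! The context `Δ` adds to `Γ` one definition, of a fresh name, so validity needs three things: `Γ`
is valid, the type `Tm.pis qs (set 0)` lies in some universe, and the value has that type.

Two inductions supply most of this. The first shows that a derivable judgment always lives in a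
valid context (`Derivable.valid_ctx`). Inverting the validity of an extended context then recovers
the typing of the hypothesis's type, a premise of the abstraction rule that elaboration does not
always provide. The second, `Elaborates.sound`, is a simultaneous induction over checking, synthesis
and elaboration of arguments: every elaborated term has its stated type, and every code is a
description. Simultaneity is essential, because checking accepts the code of an argument list with
no typing premise, only the fact that it was elaborated.

It remains to see that `D p₁ … pₙ` is a label in the context of parameters, where its arguments are
variables and hence typed (`Derivable.paramLabel`). The choice of constructors then inhabits the
type of this label, its call is a description, the fix-point of that is a small type, and
abstraction over the telescope gives the value of `D`. -/

namespace DescTT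

open Tm Judgment ElabJudgment

/-! ### Valid contexts and abstraction over hypotheses -/

/-- The context of a judgment. -/
def Judgment.ctx : Judgment → Ctx
  | .valid Γ => Γ
  | .typ Γ _ _ => Γ
  | .eq Γ _ _ _ => Γ
  | .label Γ _ => Γ

/-- Every derivable judgment is made in a valid context. -/
theorem Derivable.valid_ctx {j : Judgment} (h : Derivable j) : Valid j.ctx := by
  induction h with
  | valid_nil => exact .valid_nil
  | valid_hyp h hS hx => exact .valid_hyp h hS hx
  | valid_defn h hS ht hx => exact .valid_defn h hS ht hx
  -- Apart from the two context extensions, every rule that does not start from validity has at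
  -- least one premise in the context of its conclusion, binding rules included, and the induction
  -- hypothesis for it is the claim.
  | _ => assumption

/-- The type of a hypothesis in a valid context is well typed. -/
theorem Valid.hyp_inv {Γ : Ctx} {x : String} {S : Tm} (h : Valid (Ctx.hyp Γ x S)) :
    Valid Γ ∧ ∃ k, Derivable (typ Γ S (Tm.set k)) := by
  -- The absent value distinguishes a hypothesis from a definition, so a single rule can have
  -- produced this context.
  cases h with
  | valid_hyp hΓ hS => exact ⟨hΓ, _, hS⟩

theorem Valid.of_tele {qs : List (String × Tm)} :
    ∀ {Γ : Ctx}, Valid (Ctx.tele Γ qs) → Valid Γ := by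
  induction qs with
  | nil => exact id
  | cons q qs ih => exact fun h => (Valid.hyp_inv (ih h)).1

/-- The universes are cumulative. -/
theorem Derivable.cumul_le {Γ : Ctx} {T : Tm} {j k : ℕ} (hjk : j ≤ k)
    (h : Derivable (typ Γ T (Tm.set j))) : Derivable (typ Γ T (Tm.set k)) := by
  induction hjk with
  | refl => exact h
  | step _ ih => exact .cumul ih

/-- Abstraction of a well-typed term over the last hypothesis. -/
theorem Derivable.abs {Γ : Ctx} {x : String} {S t T : Tm}
    (h : Derivable (typ (Ctx.hyp Γ x S) t T)) :
    Derivable (typ Γ (Tm.lam S t) (Tm.pi S T)) := by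
  -- The formation premise for the domain is read off from the validity of the extended context, so
  -- callers need not provide it.
  obtain ⟨-, k, hS⟩ := Valid.hyp_inv h.valid_ctx
  exact .lam hS h

/-- Abstraction of a well-typed term over a telescope of hypotheses. -/
theorem Derivable.lams {t T : Tm} {qs : List (String × Tm)} :
    ∀ {Γ : Ctx}, Derivable (typ (Ctx.tele Γ qs) t T) →
      Derivable (typ Γ (Tm.lams qs t) (Tm.pis qs T)) := by
  induction qs with
  | nil => exact id
  | cons q qs ih => exact fun h => (ih h).abs

/-! ### Well-typedness of elaborated terms -/

/-- What the soundness of elaboration asserts of each elaboration judgment. -/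
def ElabJudgment.Sound : ElabJudgment → Prop
  | .check Γ T _ u => Derivable (typ Γ u T)
  | .synth Γ _ u T => Derivable (typ Γ u T)
  | .args Γ _ _ code => Derivable (typ Γ code Tm.desc)

/-- Terms produced by elaboration are well typed. -/
theorem Elaborates.sound {j : ElabJudgment} (h : Elaborates j) : j.Sound := by
  induction h with
  | var hΓ he _ => exact .var hΓ he
  | core h => exact h
  | app _ _ ihf ihs => exact .app ihf ihs
  | fst _ ih => exact .fst ih
  | snd _ ih => exact .snd ih
  | ann _ _ _ ih => exact ih
  | synth_conv _ h ih => exact .conv ih h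
  | switch _ ih => exact ih
  | check_conv _ h ih => exact .conv ih h
  | cumul _ hjk ih => exact ih.cumul_le hjk
  -- `j < k` unfolds to `j + 1 ≤ k`, and `set j` lies in `set (j + 1)`.
  | set hΓ hjk => exact (Derivable.set hΓ).cumul_le hjk
  | pi _ _ ihS ihT => exact .pi ihS ihT
  | sig _ _ ihS ihT => exact .sig ihS ihT
  | unit hΓ => exact (Derivable.unit hΓ).cumul_le (Nat.zero_le _)
  -- The checking rule never asks that the domain be a type; the context of the body guarantees it.
  | lam _ ih => exact ih.abs
  | pair hT _ _ ihs iht => exact .pair ihs hT iht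
  | tuple_nil hΓ => exact .star hΓ
  | tuple_cons hT _ _ ihs iht => exact .pair ihs hT iht
  | coll_nil hΓ => exact .nilE hΓ
  | coll_cons _ ih => exact .consE (.tag ih.valid_ctx) ih
  | cases _ hP _ ihE ihes => exact .enumElim ihE hP ihes
  | tag hΓ => exact .tag hΓ
  | tag_zero hE => exact .zeroE (.tag hE.valid_ctx) hE
  | tag_suc hE _ ih => exact .sucE (.tag hE.valid_ctx) hE ih
  | con hD _ ih => exact .con hD ih
  | icon hI hR hi _ ih => exact .icon hI hR hi ih
  | constr _ ih => exact ih
  | iconstr _ _ ih => exact ih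
  -- The typing comes from the induction hypothesis for the argument list that produced the code.
  | code _ ih => exact ih
  -- Weakening fixes the closed term `desc`, so the abstraction's type is the required `arr U desc`
  -- by computation.
  | args_sigma _ _ ihU ihc => exact .dsigma ihU ihc.abs
  | args_rec _ _ ihc => exact .dtimes (.dvar ihc.valid_ctx) ihc
  | args_pi _ _ _ ihU ihb ihc => exact .dtimes (.dpi ihU ihb.abs) ihc
  | args_nil hΓ => exact .dunit hΓ

/-- The premises of `dret` are the soundness of the enumeration and of the function by cases. The
codes enter through the branches of that function, so soundness of its elaboration already accounts
for them. -/
theorem ElabChoices.sound {Γ : Ctx} {cs : List Constr} {l code : Tm}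
    (hl : Derivable (label Γ l)) (h : ElabChoices Γ cs l code) :
    Derivable (typ Γ code (Tm.dlab l)) := by
  cases h with
  | intro _ hE hT => exact .dret hl hE.sound hT.sound

/-! ### Well-formedness of the label of the parameters -/

namespace Tm

/-- A label of parameters contains no binder, so fusion of renamings never meets `upr` and follows
by induction on the number of parameters. -/
theorem rename_rename_paramLabel (ρ τ : ℕ → ℕ) (D : String) (n : ℕ) :
    rename τ (rename ρ (paramLabel D n)) = rename (τ ∘ ρ) (paramLabel D n) := by
  induction n generalizing ρ τ with
  | zero => rfl
  | succ n ih => simp [paramLabel, wk, rename, ih, Function.comp_assoc]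

end Tm

/-- Each argument is a variable, which is typed as soon as its index falls inside a valid context.
Allowing an arbitrary renaming absorbs the weakenings in `paramLabel`, so derivations themselves
never have to be weakened. -/
theorem Derivable.paramLabel_rename {Γ : Ctx} (hΓ : Valid Γ) (D : String) (n : ℕ) (ρ : ℕ → ℕ)
    (hρ : ∀ i < n, ρ i < Γ.length) : Derivable (label Γ (rename ρ (paramLabel D n))) := by
  induction n generalizing ρ with
  | zero => exact .label_name hΓ
  | succ n ih =>
    -- The inner label is now renamed by `ρ ∘ Nat.succ`, to which the induction hypothesis applies.
    rw [paramLabel, rename, wk, rename_rename_paramLabel]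
    exact .label_app (ih _ fun i hi => hρ _ (Nat.succ_lt_succ hi))
      (.var hΓ (List.getElem?_eq_getElem (hρ 0 n.succ_pos)))

/-- The label `D p₁ … pₙ` is well formed in any valid context with at least `n` entries. -/
theorem Derivable.paramLabel {Γ : Ctx} (hΓ : Valid Γ) (D : String) {n : ℕ}
    (hn : n ≤ Γ.length) : Derivable (label Γ (Tm.paramLabel D n)) := by
  cases n with
  | zero => exact .label_name hΓ
  | succ n =>
    -- The renaming here is `Nat.succ`, hidden in `wk`.
    exact .label_app (paramLabel_rename hΓ D n _ fun i hi => show i + 1 < Γ.length by omega)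
      (.var hΓ (List.getElem?_eq_getElem (show 0 < Γ.length by omega)))

theorem Ctx.length_tele (qs : List (String × Tm)) (Γ : Ctx) :
    (Ctx.tele Γ qs).length = Γ.length + qs.length := by
  induction qs generalizing Γ with
  | nil => rfl
  | cons q qs ih => simp [Ctx.tele, ih, Ctx.hyp]; omega

/-- The enumeration of tags is elaborated even when there are no constructors, and its typing
already carries the validity of the context. -/
theorem ElabChoices.valid_ctx {Γ : Ctx} {cs : List Constr} {l code : Tm}
    (h : ElabChoices Γ cs l code) : Valid Γ := by
  cases h with
  | intro _ hE _ => exact hE.sound.valid_ctx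

end DescTT

theorem mainTheorem2 (Γ Δ : DescTT.Ctx) (D : String) (ps : List (String × DescTT.Ext))
    (choices : List DescTT.Constr) (h : DescTT.ElabData Γ D ps choices Δ) :
    DescTT.Valid Δ := by
  cases h with
  | @intro qs code hD _ hP hc =>
    have hΓ := hc.valid_ctx
    -- The context of parameters has `Γ.length + qs.length` entries, enough for all `qs.length`
    -- variables of the label.
    have hl := DescTT.Derivable.paramLabel hΓ D (n := qs.length)
      (by rw [DescTT.Ctx.length_tele]; omega)
    -- Validity of `Γ` comes from dropping the parameters from their valid context. The function
    -- type lies in `set 1` by soundness of its own elaboration, while the fix-point lies in `set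
    -- 0`, the codomain.
    exact .valid_defn hΓ.of_tele hP.sound (.lams (.mu (.dcall (hc.sound hl)))) hD
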